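/- Let $\mathcal H$ be a complex Hilbert space and let $M\subseteq\mathcal B(\mathcal H)$ be a von Neumann algebra with separable predual, i.e. the Banach space $M_*$ of ultraweakly continuous linear functionals on $M$ is separable in norm. For a von Neumann algebra $N$ write $(N)_1=\{x\in N:\|x\|\le 1\}$. Let $\mathcal S(M)$ be the set of von Neumann subalgebras of $M$ with the same unit as $M$ (the identity operator of $\mathcal H$), endowed with the Maréchal topology: identifying $N\in\mathcal S(M)$ with $(N)_1$, it is the topology induced by the Vietoris topology on the space of weakly closed subsets of $(M)_1$, where $(M)_1$ carries the weak operator topology; that is, the topology generated by the sets $\{N:(N)_1\subseteq U\}$ and $\{N:(N)_1\cap U\neq\emptyset\}$ with $U$ weakly open in $(M)_1$. The strong-$*$ topology on $\mathcal B(\mathcal H)$ is the one for which $x_i\to x$ if and only if $\|x_i\xi-x\xi\|\to0$ and $\|x_i^*\xi-x^*\xi\|\to0$ for every $\xi\in\mathcal H$. Then there is a sequence of maps $x_n:\mathcal S(M)\to (M)_1$, $n\in\mathbb N$, each continuous from the Maréchal topology to the strong-$*$ topology, such that for every $N\in\mathcal S(M)$ the set $\{x_n(N):n\in\mathbb N\}$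 is contained in $(N)_1$ and is dense in $(N)_1$ for the strong-$*$ topology. -/

import Mathlib

open scoped Topology InnerProductSpace

noncomputable section

namespace VonNeumannAlgebra

/-! ### Topologies on `B(H)` -/

section Topologies

variable (H : Type*) [NormedAddCommGroup H] [InnerProductSpace ℂ H] [CompleteSpace H]

/-- The weak (operator) topology on `B(H)`, carried by the type `H →L[ℂ] H` itself. -/
@[reducible] def weakTopology : TopologicalSpace (H →L[ℂ] H) :=
  TopologicalSpace.induced
    (fun x : H →L[ℂ] H => (ContinuousLinearMapWOT.ofCLM x : H →WOT[ℂ] H)) inferInstance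

/-- The strong-* topology on `B(H)`: `xᵢ → x` iff `xᵢ ξ → x ξ` and `xᵢ* ξ → x* ξ` in norm,
for every vector `ξ`. -/
@[reducible] def strongStarTopology : TopologicalSpace (H →L[ℂ] H) :=
  TopologicalSpace.induced
    (fun x : H →L[ℂ] H => ((fun ξ : H => x ξ), (fun ξ : H => (star x) ξ))) inferInstance

/-- The ultraweak topology on `B(H)`: the coarsest topology for which all the functionals
`x ↦ ∑ₙ ⟪ξₙ, x ηₙ⟫`, with `(ξₙ)` and `(ηₙ)` square-summable sequences of vectors, are
continuous. These are exactly the functionals `x ↦ Tr (t x)` with `t` of trace class. -/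
@[reducible] def ultraweakTopology : TopologicalSpace (H →L[ℂ] H) :=
  TopologicalSpace.induced
    (fun (x : H →L[ℂ] H) (p : lp (fun _ : ℕ => H) 2 × lp (fun _ : ℕ => H) 2) =>
      ∑' n, ⟪p.1 n, x (p.2 n)⟫_ℂ) inferInstance

end Topologies

variable {H : Type*} [NormedAddCommGroup H] [InnerProductSpace ℂ H] [CompleteSpace H]

/-! ### The predual -/

/-- The predual `M_*` of a von Neumann algebra `M` on `H`: the space of ultraweakly continuous
linear functionals on `M`, as a subspace of the normed dual of `M`. -/
def predual (M : VonNeumannAlgebra H) : Submodule ℂ (StrongDual ℂ M.toStarSubalgebra) where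
  carrier := {φ | Continuous[(ultraweakTopology H).induced Subtype.val, inferInstance] φ}
  zero_mem' := @continuous_const _ _ ((ultraweakTopology H).induced Subtype.val) _ _
  add_mem' hφ hψ := @Continuous.add _ _ _ _ _ ((ultraweakTopology H).induced Subtype.val) _ _ hφ hψ
  smul_mem' c _ hφ :=
    @Continuous.const_smul _ _ _ _ _ _ ((ultraweakTopology H).induced Subtype.val) _ hφ c

/-- `M` has separable predual: the Banach space `M_*` is separable in norm. -/
def HasSeparablePredual (M : VonNeumannAlgebra H) : Prop :=
  TopologicalSpace.SeparableSpace M.predual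

/-! ### The space of von Neumann subalgebras -/

/-- The closed unit ball `(M)₁` for the operator norm. -/
def unitBall (M : VonNeumannAlgebra H) : Set (H →L[ℂ] H) :=
  {x | x ∈ M ∧ ‖x‖ ≤ 1}

/-- The space `S(M)` of von Neumann subalgebras of `M` with the same unit as `M`. The unit of `M`,
as of every term of type `VonNeumannAlgebra H`, is the identity operator of `H`. -/
def Subalgebras (M : VonNeumannAlgebra H) : Type _ :=
  {N : VonNeumannAlgebra H // N ≤ M}

/-- The Maréchal topology on `S(M)`: identify `N` with its closed unit ball, a closed subset of
`(M)₁` with the weak topology, and take the topology induced by the Vietoris topology. -/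
@[reducible] def marechalTopology (M : VonNeumannAlgebra H) : TopologicalSpace M.Subalgebras :=
  TopologicalSpace.induced
    (fun N => {x : M.unitBall | (x : H →L[ℂ] H) ∈ N.1.unitBall})
    (@TopologicalSpace.vietoris M.unitBall ((weakTopology H).induced Subtype.val))

end VonNeumannAlgebra

end

/-! ### The Russo–Dye theorem. -/

section RussoDye

variable {A : Type*} [CStarAlgebra A]

/-! The selections are nearest-point projections. Separability of `M_*` yields `η` in ℓ²(ℕ, H) whose
Hilbert seminorm, with square `starSq η`, controls the strong-* topology on `(M)₁`, and a sequence
`y n` in `(M)₁` dense for that seminorm. Let `x_n(N)` be a point of `(N)₁` nearest to `y n`. It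
exists because `(N)₁` is weakly compact and the seminorm weakly lower semicontinuous; the
parallelogram law makes it unique up to seminorm zero. Density follows at once from that of `y n`.

Continuity at `N₀` uses both halves of the Vietoris topology. The sets `{N | (N)₁ ⊆ U}` keep the
distance from `y n` to `(N)₁` from dropping suddenly. The sets `{N | (N)₁ ∩ U ≠ ∅}` give only weak
approximation of elements of `(N₀)₁`, but seminorm approximation is needed. At a unitary the
seminorm is maximal on the unit ball, so weak approximation by contractions is automatically strong;
Russo–Dye extends this to all of `(N₀)₁` (`eventually_exists_starSq_sub_lt`). The parallelogram law
then forces the nearest points to converge. -/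

theorem CStarAlgebra.norm_le_one_of_mem_unitary {u : A} (hu : u ∈ unitary A) : ‖u‖ ≤ 1 := by
  rcases subsingleton_or_nontrivial A with h | h
  · simp [Subsingleton.elim u 0]
  · exact (CStarRing.norm_of_mem_unitary hu).le

/-- An invertible contraction of a C⋆-algebra is a mean of two unitaries. -/
theorem CStarAlgebra.exists_unitary_midpoint_of_isUnit {a : A} (ha : IsUnit a) (ha1 : ‖a‖ ≤ 1) :
    ∃ v ∈ unitary A, ∃ w ∈ unitary A, a = (2⁻¹ : ℝ) • v + (2⁻¹ : ℝ) • w := by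
  let _ := CStarAlgebra.spectralOrder A
  let _ := CStarAlgebra.spectralOrderedRing A
  set p := CFC.abs a with hp
  have hpp : p * p = star a * a := CFC.abs_mul_abs a
  have hps : IsSelfAdjoint p := (CFC.abs_nonneg a).isSelfAdjoint
  have hpu : IsUnit p := by
    have : IsUnit (p * p) := by rw [hpp]; exact ha.star.mul ha
    exact ((Commute.refl p).isUnit_mul_iff.1 this).1
  obtain ⟨q, hq⟩ := hpu
  have hqs : star (↑q⁻¹ : A) = ↑q⁻¹ := by
    have h : star q = q := Units.ext (by rw [Units.coe_star, hq]; exact hps)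
    rw [← Units.coe_star, star_inv, h]
  set b : A := a * ↑q⁻¹ with hb
  have hbs : star b * b = 1 := by
    rw [hb, star_mul, hqs, mul_assoc, ← mul_assoc (star a), ← hpp, ← hq]
    simp
  have hbu : IsUnit b := ha.mul (Units.isUnit _)
  have hbU : b ∈ unitary A := by
    refine ⟨hbs, ?_⟩
    obtain ⟨r, hr⟩ := hbu
    have : star b = ↑r⁻¹ := by rw [← hr] at hbs ⊢; exact Units.eq_inv_of_mul_eq_one_right hbs
    rw [this, ← hr, Units.mul_inv]
  have hp1 : ‖p‖ ≤ 1 := by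
    have h1 : ‖p‖ * ‖p‖ = ‖a‖ * ‖a‖ := by
      rw [← CStarRing.norm_star_mul_self, ← CStarRing.norm_star_mul_self, hps.star_eq, hpp]
    rwa [← mul_self_inj (norm_nonneg p) (norm_nonneg a) |>.1 h1] at ha1
  -- With `w = p + i√(1 - p²)`, the positive part `p` of the polar decomposition `a = b p` is the
  -- mean of `w` and `w*`.
  set w := selfAdjoint.unitarySelfAddISMul ⟨p, hps⟩ hp1 with hw
  have hw2 := selfAdjoint.realPart_unitarySelfAddISMul ⟨p, hps⟩ hp1
  refine ⟨b * w, mul_mem hbU w.2, b * star (w : A), mul_mem hbU (Unitary.star_mem w.2), ?_⟩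
  have : p = (2⁻¹ : ℝ) • (w : A) + (2⁻¹ : ℝ) • star (w : A) := by
    have := congrArg Subtype.val hw2
    rw [realPart_apply_coe] at this
    rw [← smul_add]; exact this.symm
  rw [← mul_smul_comm, ← mul_smul_comm, ← mul_add, ← this, hb, mul_assoc, ← hq]
  simp

/-- The **Russo–Dye theorem**. -/
theorem CStarAlgebra.mem_closure_convexHull_unitary {x : A} (hx : ‖x‖ ≤ 1) :
    x ∈ closure (convexHull ℝ (unitary A : Set A)) := by
  set C := convexHull ℝ (unitary A : Set A) with hC
  have hCc : Convex ℝ C := convex_convexHull ℝ _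
  have hUC : (unitary A : Set A) ⊆ C := subset_convexHull ℝ _
  have key : ∀ x : A, ‖x‖ < 1 → x ∈ closure C := by
    intro x hx
    -- By convexity `z` may be taken unitary; then `z + x` is invertible since `‖x‖ < 1`. Iterating
    -- this map from `1` stays in `C` and converges to `x`.
    have half : ∀ z ∈ C, (2⁻¹ : ℝ) • z + (2⁻¹ : ℝ) • x ∈ C := by
      have hconv : Convex ℝ {z : A | (2⁻¹ : ℝ) • z + (2⁻¹ : ℝ) • x ∈ C} := by
        intro z hz z' hz' s t hs ht hst
        have := hCc hz hz' hs ht hst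
        simp only [Set.mem_ofPred_eq] at *
        convert this using 1
        have : x = s • x + t • x := by rw [← add_smul, hst, one_smul]
        nth_rw 1 [this]
        module
      refine convexHull_min (fun u hu => ?_) hconv
      have h1 : ‖-(star u * x)‖ < 1 := by
        rw [norm_neg]
        refine lt_of_le_of_lt (norm_mul_le _ _) ?_
        have : ‖star u‖ ≤ 1 := by
          rw [norm_star]; exact CStarAlgebra.norm_le_one_of_mem_unitary hu
        nlinarith [norm_nonneg x]
      have h2 : IsUnit (1 - -(star u * x)) := isUnit_one_sub_of_norm_lt_one h1
      have h3 : u + x = u * (1 - -(star u * x)) := by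
        rw [sub_neg_eq_add, mul_add, ← mul_assoc, hu.2]; simp
      have h4 : IsUnit (u + x) := by
        rw [h3]; exact (Unitary.toUnits ⟨u, hu⟩).isUnit.mul h2
      have h5 : IsUnit ((2⁻¹ : ℝ) • u + (2⁻¹ : ℝ) • x) := by
        rw [← smul_add]
        exact h4.smul (Units.mk0 (2⁻¹ : ℝ) (by norm_num))
      have h6 : ‖(2⁻¹ : ℝ) • u + (2⁻¹ : ℝ) • x‖ ≤ 1 := by
        refine (norm_add_le _ _).trans ?_
        rw [norm_smul, norm_smul]
        have : ‖u‖ ≤ 1 := CStarAlgebra.norm_le_one_of_mem_unitary hu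
        norm_num
        linarith
      obtain ⟨v, hv, w, hw, h⟩ := CStarAlgebra.exists_unitary_midpoint_of_isUnit h5 h6
      change _ ∈ C
      rw [h]
      exact hCc (hUC hv) (hUC hw) (by norm_num) (by norm_num) (by norm_num)
    have hmem : ∀ n : ℕ, x + ((2⁻¹ : ℝ) ^ n) • (1 - x) ∈ C := by
      intro n
      induction n with
      | zero => simpa using hUC (one_mem (unitary A))
      | succ n ih =>
        convert half _ ih using 1
        rw [pow_succ]
        module
    refine mem_closure_of_tendsto (f := fun n : ℕ => x + ((2⁻¹ : ℝ) ^ n) • (1 - x))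
      (b := Filter.atTop) ?_ (Filter.Eventually.of_forall hmem)
    have h0 := (tendsto_pow_atTop_nhds_zero_of_lt_one (r := (2⁻¹ : ℝ)) (by norm_num)
      (by norm_num)).smul_const (1 - x)
    simpa using h0.const_add x
  have hball : x ∈ closure (Metric.ball (0 : A) 1) := by
    rw [closure_ball _ one_ne_zero]; simpa using hx
  exact closure_minimal (fun y hy => key y (by simpa using hy)) isClosed_closure hball

end RussoDye

namespace VonNeumannAlgebra

/-! ### Amplification to ℓ²(ℕ, H). -/

section Amplification

variable {H : Type*} [NormedAddCommGroup H] [InnerProductSpace ℂ H]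

theorem memℓp_apply (x : H →L[ℂ] H) (p : lp (fun _ : ℕ => H) 2) :
    Memℓp (fun n => x (p n)) 2 := by
  refine (lp.memℓp ((‖x‖ : ℂ) • p)).mono' fun n => (x.le_opNorm (p n)).trans_eq ?_
  rw [lp.coeFn_smul, Pi.smul_apply, norm_smul, Complex.norm_real, norm_norm]

/-- The amplification of `x` to `ℓ²(ℕ, H)`, acting coordinatewise. -/
noncomputable def ampl (x : H →L[ℂ] H) : lp (fun _ : ℕ => H) 2 →L[ℂ] lp (fun _ : ℕ => H) 2 :=
  LinearMap.mkContinuous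
    { toFun := fun p => ⟨fun n => x (p n), memℓp_apply x p⟩
      map_add' := fun p q => by ext n; exact map_add x (p n) (q n)
      map_smul' := fun c p => by ext n; exact map_smul x c (p n) } ‖x‖ fun p => by
    have h : ‖(‖x‖ : ℂ) • p‖ = ‖x‖ * ‖p‖ := by rw [norm_smul]; simp
    rw [← h]
    refine lp.norm_mono two_ne_zero fun n => (x.le_opNorm (p n)).trans_eq ?_
    rw [lp.coeFn_smul, Pi.smul_apply, norm_smul, Complex.norm_real, norm_norm]

theorem ampl_apply (x : H →L[ℂ] H) (p : lp (fun _ : ℕ => H) 2) (n : ℕ) :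
    ampl x p n = x (p n) := rfl

theorem norm_ampl_apply_le (x : H →L[ℂ] H) (p : lp (fun _ : ℕ => H) 2) :
    ‖ampl x p‖ ≤ ‖x‖ * ‖p‖ :=
  (ampl x).le_of_opNorm_le (LinearMap.mkContinuous_norm_le _ (norm_nonneg x) _) p

theorem ampl_add (x y : H →L[ℂ] H) : ampl (x + y) = ampl x + ampl y := by
  ext p n; simp [ampl_apply]

theorem ampl_sub (x y : H →L[ℂ] H) : ampl (x - y) = ampl x - ampl y := by
  ext p n; simp [ampl_apply]

theorem ampl_smul (c : ℂ) (x : H →L[ℂ] H) : ampl (c • x) = c • ampl x := by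
  ext p n; simp [ampl_apply]

theorem ampl_mul_apply (x y : H →L[ℂ] H) (p : lp (fun _ : ℕ => H) 2) :
    ampl (x * y) p = ampl x (ampl y p) := by
  ext n; simp [ampl_apply]

theorem inner_ampl_right [CompleteSpace H] (x : H →L[ℂ] H) (p q : lp (fun _ : ℕ => H) 2) :
    ⟪p, ampl x q⟫_ℂ = ⟪ampl (star x) p, q⟫_ℂ := by
  simp only [lp.inner_eq_tsum, ampl_apply, ContinuousLinearMap.star_eq_adjoint,
    ContinuousLinearMap.adjoint_inner_left]

theorem norm_apply_le_norm_ampl_apply (x : H →L[ℂ] H) (p : lp (fun _ : ℕ => H) 2) (n : ℕ) :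
    ‖x (p n)‖ ≤ ‖ampl x p‖ := by
  simpa [ampl_apply] using lp.norm_apply_le_norm two_ne_zero (ampl x p) n

end Amplification

/-! ### Weak continuity and compactness on bounded sets. -/

section WeakTopology

variable {H : Type*} [NormedAddCommGroup H] [InnerProductSpace ℂ H] [CompleteSpace H]

theorem continuous_inner_apply_weakTopology (ξ η : H) :
    Continuous[weakTopology H, inferInstance] fun x : H →L[ℂ] H => ⟪ξ, x η⟫_ℂ := by
  let := weakTopology H
  exact (ContinuousLinearMapWOT.continuous_inner_apply continuous_id η ξ).comp continuous_induced_dom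

/-- On the unit ball the series converges uniformly, dominated by `‖p n‖ * ‖q n‖`. -/
theorem continuousOn_inner_ampl_weakTopology (p q : lp (fun _ : ℕ => H) 2) :
    @ContinuousOn _ _ (weakTopology H) _ (fun x : H →L[ℂ] H => ⟪p, ampl x q⟫_ℂ) {x | ‖x‖ ≤ 1} := by
  let := weakTopology H
  have hs : Summable fun n => ‖p n‖ * ‖q n‖ :=
    lp.summable_mul (by rw [Real.holderConjugate_iff]; norm_num) p q
  simp only [lp.inner_eq_tsum, ampl_apply]
  refine continuousOn_tsum
    (fun n => (continuous_inner_apply_weakTopology (p n) (q n)).continuousOn) hs ?_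
  intro n x hx
  refine (norm_inner_le_norm _ _).trans ?_
  gcongr
  exact (x.le_of_opNorm_le hx _).trans (one_mul _).le

/-- Along an ultrafilter the matrix coefficients converge to a bounded sesquilinear form, which is
represented by an operator `z`; the double commutant puts `z` in `N`. -/
theorem isCompact_unitBall (N : VonNeumannAlgebra H) :
    @IsCompact _ (weakTopology H) N.unitBall := by
  let := weakTopology H
  rw [isCompact_iff_ultrafilter_le_nhds]
  intro F hF
  have hmem : N.unitBall ∈ F := Filter.le_principal_iff.1 hF
  have hbd : ∀ ξ η : H, ∀ x ∈ N.unitBall, ‖⟪ξ, x η⟫_ℂ‖ ≤ ‖ξ‖ * ‖η‖ := by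
    intro ξ η x hx
    refine (norm_inner_le_norm _ _).trans ?_
    gcongr
    exact (x.le_of_opNorm_le hx.2 _).trans (one_mul _).le
  have hlim : ∀ ξ η : H, ∃ c : ℂ, ‖c‖ ≤ ‖ξ‖ * ‖η‖ ∧
      Filter.Tendsto (fun x : H →L[ℂ] H => ⟪ξ, x η⟫_ℂ) F (𝓝 c) := by
    intro ξ η
    have hc := isCompact_closedBall (0 : ℂ) (‖ξ‖ * ‖η‖)
    rw [isCompact_iff_ultrafilter_le_nhds] at hc
    obtain ⟨c, hc, h⟩ := hc (F.map fun x : H →L[ℂ] H => ⟪ξ, x η⟫_ℂ) (by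
      rw [Filter.le_principal_iff]
      exact Filter.mem_of_superset (Filter.image_mem_map hmem) (by
        rintro _ ⟨x, hx, rfl⟩
        simpa using hbd ξ η x hx))
    exact ⟨c, by simpa using hc, h⟩
  choose B hB1 hB using hlim
  let S : H →L⋆[ℂ] H →L[ℂ] ℂ := LinearMap.mkContinuous₂
    (LinearMap.mk₂'ₛₗ (starRingEnd ℂ) (RingHom.id ℂ) B
      (fun a b c => tendsto_nhds_unique (hB (a + b) c) (by
        simpa only [inner_add_left] using (hB a c).add (hB b c)))
      (fun r a c => tendsto_nhds_unique (hB (r • a) c) (by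
        simpa only [inner_smul_left, smul_eq_mul] using (hB a c).const_mul _))
      (fun a b c => tendsto_nhds_unique (hB a (b + c)) (by
        simpa only [map_add, inner_add_right] using (hB a b).add (hB a c)))
      (fun r a c => tendsto_nhds_unique (hB a (r • c)) (by
        simpa only [map_smul, inner_smul_right, smul_eq_mul, RingHom.id_apply] using (hB a c).const_mul _)))
    1 (fun a b => by simpa using hB1 a b)
  obtain ⟨z, hz⟩ : ∃ z : H →L[ℂ] H, ∀ ξ η, ⟪ξ, z η⟫_ℂ = B ξ η := by
    refine ⟨star (InnerProductSpace.continuousLinearMapOfBilin S), fun ξ η => ?_⟩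
    rw [ContinuousLinearMap.star_eq_adjoint, ContinuousLinearMap.adjoint_inner_right,
      InnerProductSpace.continuousLinearMapOfBilin_apply]
    rfl
  refine ⟨z, ⟨?_, ?_⟩, ?_⟩
  · rw [← N.commutant_commutant, mem_commutant_iff]
    intro g hg
    have hgs : star g ∈ N.commutant := star_mem hg
    ext η
    refine ext_inner_left ℂ fun ξ => ?_
    have h1 : ⟪ξ, (g * z) η⟫_ℂ = B (star g ξ) η := by
      rw [← hz, ContinuousLinearMap.star_eq_adjoint, ContinuousLinearMap.adjoint_inner_left]; rfl
    have h2 : ⟪ξ, (z * g) η⟫_ℂ = B ξ (g η) := by rw [← hz]; rfl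
    rw [h1, h2]
    refine tendsto_nhds_unique_of_eventuallyEq (hB _ _) (hB _ _) ?_
    filter_upwards [hmem] with x hx
    have := mem_commutant_iff.1 hg x hx.1
    rw [ContinuousLinearMap.star_eq_adjoint, ContinuousLinearMap.adjoint_inner_left]
    exact congrArg (fun y : H →L[ℂ] H => ⟪ξ, y η⟫_ℂ) this.symm
  · refine z.opNorm_le_bound zero_le_one fun η => ?_
    have h := hB1 (z η) η
    rw [← hz, inner_self_eq_norm_sq_to_K] at h
    rw [one_mul]
    by_contra! hlt
    have h0 : 0 < ‖z η‖ := (norm_nonneg η).trans_lt hlt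
    simp at h
    nlinarith
  · rw [nhds_induced, ← Filter.tendsto_iff_comap]
    rw [ContinuousLinearMapWOT.tendsto_iff_forall_inner_apply_tendsto]
    intro η ξ
    have := hB ξ η
    rw [← hz] at this
    exact this

end WeakTopology

end VonNeumannAlgebra

/-- Subsets of a separable metric space are separable, so approximants can be taken of the form `f
a`. -/
theorem exists_seq_forall_dist_lt {α X : Type*} [PseudoMetricSpace X]
    [TopologicalSpace.SeparableSpace X] [Nonempty α] (f : α → X) :
    ∃ s : ℕ → α, ∀ a, ∀ ε > 0, ∃ n, dist (f a) (f (s n)) < ε := by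
  have : TopologicalSpace.SeparableSpace (Set.range f) :=
    (TopologicalSpace.IsSeparable.of_separableSpace _).separableSpace
  choose s hs using fun n => (TopologicalSpace.denseSeq (Set.range f) n).2
  refine ⟨s, fun a ε hε => ?_⟩
  obtain ⟨n, hn⟩ := (TopologicalSpace.denseRange_denseSeq (Set.range f)).exists_dist_lt
    ⟨f a, a, rfl⟩ hε
  exact ⟨n, by rw [hs]; exact hn⟩

namespace VonNeumannAlgebra

variable {H : Type*} [NormedAddCommGroup H] [InnerProductSpace ℂ H] [CompleteSpace H]

/-! ### Consequences of a separable predual. -/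

section Predual

/-- The normal functional `z ↦ ∑ₙ ⟪pₙ, z qₙ⟫` on `M`. -/
noncomputable def vectorFunctional (M : VonNeumannAlgebra H) (p q : lp (fun _ : ℕ => H) 2) :
    M.predual :=
  ⟨LinearMap.mkContinuous
    { toFun := fun z : M.toStarSubalgebra => ⟪p, ampl (z : H →L[ℂ] H) q⟫_ℂ
      map_add' := fun x y => by simp [ampl_add]
      map_smul' := fun c x => by simp [ampl_smul] } (‖p‖ * ‖q‖) (fun z => by
    refine (norm_inner_le_norm (𝕜 := ℂ) p (ampl (z : H →L[ℂ] H) q)).trans ?_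
    rw [mul_assoc, mul_comm ‖q‖]
    gcongr
    exact norm_ampl_apply_le _ _), by
    let _ := ultraweakTopology H
    have h := ((continuous_apply (p, q)).comp (continuous_induced_dom (t := inferInstance)
      (f := fun (x : H →L[ℂ] H) (p : lp (fun _ : ℕ => H) 2 × lp (fun _ : ℕ => H) 2) =>
        ∑' n, ⟪p.1 n, x (p.2 n)⟫_ℂ))).comp
      (continuous_induced_dom (f := (Subtype.val : M.toStarSubalgebra → H →L[ℂ] H)))
    refine h.congr fun z => ?_
    simp [lp.inner_eq_tsum, ampl_apply]⟩

theorem vectorFunctional_apply (M : VonNeumannAlgebra H) (p q : lp (fun _ : ℕ => H) 2)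
    (z : M.toStarSubalgebra) :
    (M.vectorFunctional p q : StrongDual ℂ M.toStarSubalgebra) z =
      ⟪p, ampl (z : H →L[ℂ] H) q⟫_ℂ := rfl

theorem norm_apply_sub_apply_le (M : VonNeumannAlgebra H) (φ ψ : M.predual)
    (z : M.toStarSubalgebra) :
    ‖(φ : StrongDual ℂ M.toStarSubalgebra) z - (ψ : StrongDual ℂ M.toStarSubalgebra) z‖ ≤
      dist φ ψ * ‖z‖ := by
  have h : dist φ ψ = ‖φ.1 - ψ.1‖ := dist_eq_norm φ.1 ψ.1
  rw [h]
  exact ContinuousLinearMap.le_opNorm (φ.1 - ψ.1) z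

/-- A square-summable sequence of vectors that controls the strong topology on bounded subsets
of `M`. -/
theorem HasSeparablePredual.exists_controlling_sequence {M : VonNeumannAlgebra H}
    (hM : M.HasSeparablePredual) :
    ∃ η : lp (fun _ : ℕ => H) 2, ∀ ξ : H, ∀ ε > 0, ∃ C : ℝ, 0 ≤ C ∧
      ∀ x ∈ M, ‖x‖ ≤ 2 → ‖x ξ‖ ^ 2 ≤ ε + C * ‖ampl x η‖ ^ 2 := by
  have : TopologicalSpace.SeparableSpace M.predual := hM
  let ω : H → M.predual := fun ξ => M.vectorFunctional (lp.single 2 0 ξ) (lp.single 2 0 ξ)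
  have hω : ∀ (ξ : H) (x : M.toStarSubalgebra),
      (ω ξ : StrongDual ℂ M.toStarSubalgebra) (star x * x) = ((‖(x : H →L[ℂ] H) ξ‖ ^ 2 : ℝ) : ℂ) := by
    intro ξ x
    rw [vectorFunctional_apply, lp.inner_single_left, ampl_apply, lp.single_apply_self]
    change ⟪ξ, (star (x : H →L[ℂ] H)) ((x : H →L[ℂ] H) ξ)⟫_ℂ = _
    rw [ContinuousLinearMap.star_eq_adjoint, ContinuousLinearMap.adjoint_inner_right,
      inner_self_eq_norm_sq_to_K]
    simp
  obtain ⟨ζ, hζ⟩ := exists_seq_forall_dist_lt ω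
  -- Positive weights with `‖c k • ζ k‖ ≤ 2⁻ᵏ`, hence square-summable.
  let c : ℕ → ℝ := fun k => (1 / 2) ^ k / (1 + ‖ζ k‖)
  have hc : ∀ k, 0 < c k := fun k => by positivity
  have hmem : Memℓp (fun k => (c k : ℂ) • ζ k) 2 := by
    have hg : Memℓp (fun k : ℕ => ((1 / 2) ^ k : ℝ)) 2 := by
      refine memℓp_gen ?_
      have : Summable fun k : ℕ => ((1 / 4 : ℝ)) ^ k :=
        summable_geometric_of_lt_one (by norm_num) (by norm_num)
      refine this.congr fun k => ?_
      rw [Real.norm_of_nonneg (by positivity)]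
      simp only [ENNReal.toReal_ofNat, Real.rpow_ofNat]
      rw [← pow_mul, mul_comm, pow_mul]; norm_num
    refine hg.mono' fun k => ?_
    rw [norm_smul, Complex.norm_real, Real.norm_of_nonneg (hc k).le,
      Real.norm_of_nonneg (by positivity)]
    have : 0 < 1 + ‖ζ k‖ := by positivity
    simp only [c]
    rw [div_mul_eq_mul_div, div_le_iff₀ this]
    gcongr
    linarith
  refine ⟨⟨_, hmem⟩, fun ξ ε hε => ?_⟩
  obtain ⟨k, hk⟩ := hζ ξ (ε / 4) (by positivity)
  refine ⟨(c k ^ 2)⁻¹, by positivity, fun x hx hx2 => ?_⟩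
  let z : M.toStarSubalgebra := ⟨x, hx⟩
  have h1 := norm_apply_sub_apply_le M (ω ξ) (ω (ζ k)) (star z * z)
  have h2 : ‖star z * z‖ ≤ 4 := by
    refine (norm_mul_le _ _).trans ?_
    rw [norm_star]
    have : ‖z‖ ≤ 2 := hx2
    nlinarith [norm_nonneg z]
  rw [hω, hω, ← Complex.ofReal_sub, Complex.norm_real, Real.norm_eq_abs] at h1
  have h3 : dist (ω ξ) (ω (ζ k)) * ‖star z * z‖ ≤ ε := by
    have := mul_le_mul hk.le h2 (norm_nonneg _) (by positivity)
    linarith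
  have h4 := norm_apply_le_norm_ampl_apply x ⟨_, hmem⟩ k
  have h5 : ‖x ((c k : ℂ) • ζ k)‖ = c k * ‖x (ζ k)‖ := by
    rw [map_smul, norm_smul, Complex.norm_real, Real.norm_of_nonneg (hc k).le]
  have h6 : ‖x (ζ k)‖ ^ 2 ≤ (c k ^ 2)⁻¹ * ‖ampl x ⟨_, hmem⟩‖ ^ 2 := by
    rw [inv_mul_eq_div, le_div_iff₀ (by have := hc k; positivity), mul_comm, ← mul_pow, ← h5]
    gcongr
  have h7 := (abs_le.1 (h1.trans h3)).2
  change ‖x ξ‖ ^ 2 - ‖x (ζ k)‖ ^ 2 ≤ ε at h7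
  linarith

/-- The square of the Hilbert seminorm `x ↦ (‖x η‖² + ‖x* η‖²)^{1/2}`. -/
noncomputable def starSq (η : lp (fun _ : ℕ => H) 2) (x : H →L[ℂ] H) : ℝ :=
  ‖ampl x η‖ ^ 2 + ‖ampl (star x) η‖ ^ 2

theorem HasSeparablePredual.exists_dense_seq {M : VonNeumannAlgebra H}
    (hM : M.HasSeparablePredual) (η : lp (fun _ : ℕ => H) 2) :
    ∃ y : ℕ → M.unitBall, ∀ x ∈ M.unitBall, ∀ ε > 0, ∃ n, starSq η (x - y n) < ε := by
  have : TopologicalSpace.SeparableSpace M.predual := hM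
  have : Nonempty M.unitBall := ⟨0, zero_mem M, by simp⟩
  let φ : M.unitBall → M.predual := fun x =>
    M.vectorFunctional (ampl (x : H →L[ℂ] H) η) η +
      M.vectorFunctional η (ampl (star (x : H →L[ℂ] H)) η)
  obtain ⟨y, hy⟩ := exists_seq_forall_dist_lt φ
  refine ⟨y, fun x hx ε hε => ?_⟩
  obtain ⟨n, hn⟩ := hy ⟨x, hx⟩ (ε / 2) (by positivity)
  refine ⟨n, ?_⟩
  let w : M.toStarSubalgebra := ⟨x - y n, sub_mem hx.1 (y n).2.1⟩
  have h1 := norm_apply_sub_apply_le M (φ ⟨x, hx⟩) (φ (y n)) w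
  have h2 : ‖w‖ ≤ 2 := by
    refine (norm_sub_le x (y n : H →L[ℂ] H)).trans ?_
    linarith [hx.2, (y n).2.2]
  -- `φ x` is the semi-inner product with `x`, so evaluating the difference at `w = x - y n` gives
  -- the squared seminorm.
  have h3 : (φ ⟨x, hx⟩ : StrongDual ℂ M.toStarSubalgebra) w -
      (φ (y n) : StrongDual ℂ M.toStarSubalgebra) w = ((starSq η (x - y n) : ℝ) : ℂ) := by
    simp only [φ, Submodule.coe_add, _root_.add_apply, vectorFunctional_apply]
    change ⟪ampl x η, ampl (x - (y n : H →L[ℂ] H)) η⟫_ℂ + ⟪η, ampl (x - (y n : H →L[ℂ] H)) (ampl (star x) η)⟫_ℂ -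
      (⟪ampl (y n : H →L[ℂ] H) η, ampl (x - (y n : H →L[ℂ] H)) η⟫_ℂ +
        ⟪η, ampl (x - (y n : H →L[ℂ] H)) (ampl (star (y n : H →L[ℂ] H)) η)⟫_ℂ) = _
    rw [add_sub_add_comm, ← inner_sub_left, ← inner_sub_right, ← map_sub,
      ← _root_.sub_apply, ← _root_.sub_apply, ← ampl_sub, ← ampl_sub,
      ← star_sub, inner_ampl_right _ η, inner_self_eq_norm_sq_to_K, inner_self_eq_norm_sq_to_K]
    simp [starSq]
  rw [h3, Complex.norm_real, Real.norm_eq_abs] at h1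
  have h4 := (le_abs_self _).trans h1
  nlinarith [norm_nonneg w, dist_nonneg (x := φ ⟨x, hx⟩) (y := φ (y n))]

end Predual

/-! ### The Hilbert seminorm. -/

section StarSq

variable (η : lp (fun _ : ℕ => H) 2)

theorem starSq_nonneg (x : H →L[ℂ] H) : 0 ≤ starSq η x := by
  unfold starSq; positivity

theorem starSq_star (x : H →L[ℂ] H) : starSq η (star x) = starSq η x := by
  rw [starSq, star_star, add_comm, starSq]

theorem starSq_add_add_starSq_sub (x y : H →L[ℂ] H) :
    starSq η (x + y) + starSq η (x - y) = 2 * (starSq η x + starSq η y) := by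
  have h1 := parallelogram_law_with_norm ℂ (ampl x η) (ampl y η)
  have h2 := parallelogram_law_with_norm ℂ (ampl (star x) η) (ampl (star y) η)
  simp only [starSq, star_add, star_sub, ampl_add, ampl_sub, _root_.add_apply, _root_.sub_apply]
  linarith

/-- A small `t` keeps the coefficient of the first term close to 1, so that distances to `y` are
perturbed only slightly. -/
theorem starSq_add_le_weighted (x y : H →L[ℂ] H) {t : ℝ} (ht : 0 < t) :
    starSq η (x + y) ≤ (1 + t) * starSq η x + (1 + t⁻¹) * starSq η y := by
  have key : ∀ p q : lp (fun _ : ℕ => H) 2,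
      ‖p + q‖ ^ 2 ≤ (1 + t) * ‖p‖ ^ 2 + (1 + t⁻¹) * ‖q‖ ^ 2 := by
    intro p q
    have h1 : ‖p + q‖ ^ 2 ≤ (‖p‖ + ‖q‖) ^ 2 := by gcongr; exact norm_add_le p q
    have h2 : 0 ≤ t⁻¹ * (t * ‖p‖ - ‖q‖) ^ 2 := by positivity
    have h3 : t⁻¹ * (t * ‖p‖ - ‖q‖) ^ 2 = t * ‖p‖ ^ 2 - 2 * ‖p‖ * ‖q‖ + t⁻¹ * ‖q‖ ^ 2 := by
      field_simp
      ring
    linarith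
  have h1 := key (ampl x η) (ampl y η)
  have h2 := key (ampl (star x) η) (ampl (star y) η)
  simp only [starSq, star_add, ampl_add, _root_.add_apply]
  linarith

theorem starSq_add_le (x y : H →L[ℂ] H) :
    starSq η (x + y) ≤ 2 * (starSq η x + starSq η y) := by
  have := starSq_add_le_weighted η x y one_pos
  rw [inv_one] at this
  linarith

theorem starSq_smul (c : ℂ) (x : H →L[ℂ] H) : starSq η (c • x) = ‖c‖ ^ 2 * starSq η x := by
  simp only [starSq, star_smul, ampl_smul, _root_.smul_apply, norm_smul, norm_star]
  ring

theorem starSq_le (x : H →L[ℂ] H) : starSq η x ≤ 2 * (‖x‖ * ‖η‖) ^ 2 := by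
  have h1 := norm_ampl_apply_le x η
  have h2 := norm_ampl_apply_le (star x) η
  rw [norm_star] at h2
  rw [starSq, two_mul]
  gcongr

/-- The real part of the semi-inner product that polarizes `starSq η`. -/
noncomputable def starInner (x y : H →L[ℂ] H) : ℝ :=
  (⟪ampl x η, ampl y η⟫_ℂ).re + (⟪η, ampl y (ampl (star x) η)⟫_ℂ).re

theorem starSq_sub (x y : H →L[ℂ] H) :
    starSq η (x - y) = starSq η x + starSq η y - 2 * starInner η y x := by
  have h1 := norm_sub_sq (𝕜 := ℂ) (ampl x η) (ampl y η)
  have h2 := norm_sub_sq (𝕜 := ℂ) (ampl (star x) η) (ampl (star y) η)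
  rw [← inner_re_symm] at h1
  rw [starInner, inner_ampl_right x η]
  simp only [starSq, star_sub, ampl_sub, _root_.sub_apply]
  simp only [RCLike.re_to_complex] at h1 h2
  linarith

theorem starInner_self (x : H →L[ℂ] H) : starInner η x x = starSq η x := by
  have h := starSq_sub η x x
  have h0 : starSq η (0 : H →L[ℂ] H) = 0 :=
    le_antisymm (by simpa using starSq_le η (0 : H →L[ℂ] H)) (starSq_nonneg η _)
  rw [sub_self, h0] at h
  linarith

theorem continuousOn_starInner (x : H →L[ℂ] H) :
    @ContinuousOn _ _ (weakTopology H) _ (starInner η x) {y | ‖y‖ ≤ 1} := by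
  let _ := weakTopology H
  exact (Complex.continuous_re.comp_continuousOn (continuousOn_inner_ampl_weakTopology _ _)).add
    (Complex.continuous_re.comp_continuousOn (continuousOn_inner_ampl_weakTopology _ _))

/-- Expanding `starSq η (x - x₀) ≥ 0` bounds the function below by a weakly continuous one with
equality at `x₀`. -/
theorem lowerSemicontinuousOn_starSq_sub (y : H →L[ℂ] H) :
    @LowerSemicontinuousOn _ ℝ (weakTopology H) _ (fun x => starSq η (x - y)) {x | ‖x‖ ≤ 1} := by
  let _ := weakTopology H
  intro x₀ hx₀ c hc
  have hcont : ContinuousOn (fun x => 2 * starInner η x₀ x - starSq η x₀ + starSq η y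
      - 2 * starInner η y x) {x | ‖x‖ ≤ 1} :=
    (((continuousOn_const.mul (continuousOn_starInner η x₀)).sub continuousOn_const).add
      continuousOn_const).sub (continuousOn_const.mul (continuousOn_starInner η y))
  have hlt : c < 2 * starInner η x₀ x₀ - starSq η x₀ + starSq η y - 2 * starInner η y x₀ := by
    have := starSq_sub η x₀ y
    rw [starInner_self]
    linarith
  filter_upwards [(hcont x₀ hx₀).eventually_const_lt hlt] with x hx
  have h1 := starSq_sub η x y
  have h2 := starSq_sub η x x₀
  have h3 := starSq_nonneg η (x - x₀)
  linarith

end StarSq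

theorem unitBall_nonempty (N : VonNeumannAlgebra H) : N.unitBall.Nonempty :=
  ⟨0, zero_mem N, by simp⟩

theorem exists_nearest (η : lp (fun _ : ℕ => H) 2) (N : VonNeumannAlgebra H) (y : H →L[ℂ] H) :
    ∃ p ∈ N.unitBall, ∀ x ∈ N.unitBall, starSq η (p - y) ≤ starSq η (x - y) := by
  let _ := weakTopology H
  obtain ⟨p, hp, h⟩ := ((lowerSemicontinuousOn_starSq_sub η y).mono fun x hx => hx.2).exists_isMinOn
    N.unitBall_nonempty N.isCompact_unitBall
  exact ⟨p, hp, fun x hx => h hx⟩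

theorem smul_mem_of_mem (N : VonNeumannAlgebra H) (c : ℂ) {x : H →L[ℂ] H} (hx : x ∈ N) :
    c • x ∈ N :=
  N.toStarSubalgebra.smul_mem hx c

/-- Parallelogram law: the midpoint of `x` and `p` lies in the ball, hence is no closer to `y` than
`p`. -/
theorem starSq_sub_nearest_le {η : lp (fun _ : ℕ => H) 2} {N : VonNeumannAlgebra H}
    {y p : H →L[ℂ] H} (hp : p ∈ N.unitBall)
    (hmin : ∀ x ∈ N.unitBall, starSq η (p - y) ≤ starSq η (x - y))
    {x : H →L[ℂ] H} (hx : x ∈ N.unitBall) :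
    starSq η (p - x) ≤ 2 * (starSq η (x - y) - starSq η (p - y)) := by
  have hmid : (2⁻¹ : ℂ) • (x + p) ∈ N.unitBall := by
    refine ⟨smul_mem_of_mem N _ (add_mem hx.1 hp.1), ?_⟩
    rw [norm_smul]
    have := norm_add_le x p
    have := hx.2
    have := hp.2
    norm_num
    linarith
  have h1 := hmin _ hmid
  have h2 := starSq_add_add_starSq_sub η (p - y) (x - y)
  have h3 : p - y + (x - y) = (2 : ℂ) • ((2⁻¹ : ℂ) • (x + p) - y) := by module
  have h4 : p - y - (x - y) = p - x := by abel
  rw [h3, h4, starSq_smul] at h2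
  norm_num at h2
  norm_num at h1
  linarith

/-! ### Continuity for the Maréchal topology. -/

section Marechal

variable {M : VonNeumannAlgebra H}

theorem isOpen_setOf_lt_unitBall (M : VonNeumannAlgebra H) {f : (H →L[ℂ] H) → ℝ}
    (hf : @LowerSemicontinuousOn _ ℝ (weakTopology H) _ f {x | ‖x‖ ≤ 1}) (c : ℝ) :
    @IsOpen M.unitBall ((weakTopology H).induced Subtype.val) {x | c < f x} := by
  let _ := weakTopology H
  have h : LowerSemicontinuous fun x : M.unitBall => f x := by
    intro x c hc
    have ht : Filter.Tendsto (Subtype.val : M.unitBall → H →L[ℂ] H) (𝓝 x) (𝓝[{x | ‖x‖ ≤ 1}] x) :=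
      tendsto_nhdsWithin_iff.2 ⟨continuous_subtype_val.continuousAt,
        Filter.Eventually.of_forall fun x => x.2.2⟩
    exact ht.eventually (hf x x.2.2 c hc)
  exact h.isOpen_preimage c

theorem eventually_exists_lt {f : (H →L[ℂ] H) → ℝ}
    (hf : @LowerSemicontinuousOn _ ℝ (weakTopology H) _ f {x | ‖x‖ ≤ 1}) {N₀ : M.Subalgebras}
    {x₀ : H →L[ℂ] H} (hx₀ : x₀ ∈ N₀.1.unitBall) {c : ℝ} (hc : c < f x₀) :
    ∀ᶠ N in @nhds _ M.marechalTopology N₀, ∃ x ∈ N.1.unitBall, c < f x := by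
  let _ : TopologicalSpace M.unitBall := (weakTopology H).induced Subtype.val
  let _ := TopologicalSpace.vietoris M.unitBall
  let _ := M.marechalTopology
  have ho := (TopologicalSpace.vietoris.isOpen_inter_nonempty_of_isOpen
    (M.isOpen_setOf_lt_unitBall hf c)).preimage (continuous_induced_dom
      (f := fun N : M.Subalgebras => {x : M.unitBall | (x : H →L[ℂ] H) ∈ N.1.unitBall}))
  have hmem := ho.mem_nhds (x := N₀) ⟨⟨x₀, N₀.2 hx₀.1, hx₀.2⟩, hx₀, hc⟩
  filter_upwards [hmem] with N hN
  obtain ⟨x, hx, hcx⟩ := hN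
  exact ⟨x, hx, hcx⟩

theorem eventually_forall_lt {f : (H →L[ℂ] H) → ℝ}
    (hf : @LowerSemicontinuousOn _ ℝ (weakTopology H) _ f {x | ‖x‖ ≤ 1}) {N₀ : M.Subalgebras}
    {c : ℝ} (hc : ∀ x ∈ N₀.1.unitBall, c < f x) :
    ∀ᶠ N in @nhds _ M.marechalTopology N₀, ∀ x ∈ N.1.unitBall, c < f x := by
  let _ : TopologicalSpace M.unitBall := (weakTopology H).induced Subtype.val
  let _ := TopologicalSpace.vietoris M.unitBall
  let _ := M.marechalTopology
  have ho := (M.isOpen_setOf_lt_unitBall hf c).powerset_vietoris.preimage (continuous_induced_dom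
      (f := fun N : M.Subalgebras => {x : M.unitBall | (x : H →L[ℂ] H) ∈ N.1.unitBall}))
  have hmem := ho.mem_nhds (x := N₀) (fun x hx => hc x hx)
  filter_upwards [hmem] with N hN x hx
  exact hN (a := ⟨x, N.2 hx.1, hx.2⟩) hx

theorem isClosed_coe_toStarSubalgebra (N : VonNeumannAlgebra H) :
    IsClosed (N.toStarSubalgebra : Set (H →L[ℂ] H)) := by
  rw [coe_toStarSubalgebra, ← centralizer_centralizer]
  exact Set.isClosed_centralizer _

/-- Elements of a subalgebra are approximated, in the seminorm given by `η`, by elements of the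
unit balls of nearby subalgebras. -/
theorem eventually_exists_starSq_sub_lt (η : lp (fun _ : ℕ => H) 2) {N₀ : M.Subalgebras}
    {a : H →L[ℂ] H} (ha : a ∈ N₀.1.unitBall) {δ : ℝ} (hδ : 0 < δ) :
    ∀ᶠ N in @nhds _ M.marechalTopology N₀, ∃ x ∈ N.1.unitBall, starSq η (x - a) < δ := by
  let _ := M.marechalTopology
  have := N₀.1.isClosed_coe_toStarSubalgebra
  let C : Set N₀.1.toStarSubalgebra := {a | ∀ δ > 0, ∀ᶠ N in 𝓝 N₀, ∃ x ∈ N.1.unitBall,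
    starSq η (x - (a : H →L[ℂ] H)) < δ}
  have hU : (unitary N₀.1.toStarSubalgebra : Set N₀.1.toStarSubalgebra) ⊆ C := by
    intro u hu δ hδ
    have hu1 : star (u : H →L[ℂ] H) * u = 1 := congrArg Subtype.val hu.1
    have hu2 : (u : H →L[ℂ] H) * star (u : H →L[ℂ] H) = 1 := congrArg Subtype.val hu.2
    have hun : ‖(u : H →L[ℂ] H)‖ ≤ 1 := CStarAlgebra.norm_le_one_of_mem_unitary ⟨hu1, hu2⟩
    have hiso : ∀ v : H →L[ℂ] H, star v * v = 1 → ‖ampl v η‖ = ‖η‖ := by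
      intro v hv
      have h1 : ⟪ampl v η, ampl v η⟫_ℂ = ⟪η, η⟫_ℂ := by
        rw [inner_ampl_right, ← ampl_mul_apply, hv]
        congr 1
      rw [norm_eq_sqrt_re_inner (𝕜 := ℂ), h1, ← norm_eq_sqrt_re_inner]
    have hsq : starSq η u = 2 * ‖η‖ ^ 2 := by
      rw [starSq, hiso _ hu1, hiso _ (by rw [star_star]; exact hu2)]; ring
    have hlsc : @LowerSemicontinuousOn _ ℝ (weakTopology H) _ (starInner η u) {x | ‖x‖ ≤ 1} :=
      @ContinuousOn.lowerSemicontinuousOn _ (weakTopology H) _ _ _ _ _ _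
        (continuousOn_starInner η u)
    -- As `starSq η x ≤ 2‖η‖² = starSq η u`, a semi-inner product with `u` above `starSq η u - δ /
    -- 2` forces `starSq η (x - u) < δ`.
    filter_upwards [eventually_exists_lt hlsc (N₀ := N₀) (x₀ := u) ⟨u.2, hun⟩
      (c := starSq η u - δ / 2) (by rw [starInner_self]; linarith)] with N ⟨x, hx, hlt⟩
    refine ⟨x, hx, ?_⟩
    have h1 : starSq η x ≤ 2 * ‖η‖ ^ 2 := by
      refine (starSq_le η x).trans ?_
      have : ‖x‖ * ‖η‖ ≤ ‖η‖ := mul_le_of_le_one_left (norm_nonneg _) hx.2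
      gcongr
    have h2 := starSq_sub η x u
    linarith
  have hconv : Convex ℝ C := by
    intro a ha b hb s t hs ht hst δ hδ
    filter_upwards [ha (δ / 4) (by positivity), hb (δ / 4) (by positivity)]
      with N ⟨x, hx, hxa⟩ ⟨y, hy, hyb⟩
    refine ⟨(s : ℂ) • x + (t : ℂ) • y, ⟨add_mem (smul_mem_of_mem _ _ hx.1)
      (smul_mem_of_mem _ _ hy.1), ?_⟩, ?_⟩
    · refine (norm_add_le _ _).trans ?_
      rw [norm_smul, norm_smul, Complex.norm_real, Complex.norm_real, Real.norm_of_nonneg hs,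
        Real.norm_of_nonneg ht]
      nlinarith [hx.2, hy.2]
    · have h1 : (s : ℂ) • x + (t : ℂ) • y - ((s • a + t • b : N₀.1.toStarSubalgebra) : H →L[ℂ] H) =
          (s : ℂ) • (x - a) + (t : ℂ) • (y - b) := by
        have : ((s • a + t • b : N₀.1.toStarSubalgebra) : H →L[ℂ] H) =
          (s : ℂ) • (a : H →L[ℂ] H) + (t : ℂ) • (b : H →L[ℂ] H) := rfl
        rw [this]; module
      rw [h1]
      refine (starSq_add_le η _ _).trans_lt ?_
      rw [starSq_smul, starSq_smul, Complex.norm_real, Complex.norm_real, Real.norm_of_nonneg hs,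
        Real.norm_of_nonneg ht]
      have h2 : s ^ 2 ≤ 1 := pow_le_one₀ hs (by linarith)
      have h3 : t ^ 2 ≤ 1 := pow_le_one₀ ht (by linarith)
      have h4 := mul_le_of_le_one_left (starSq_nonneg η (x - a)) h2
      have h5 := mul_le_of_le_one_left (starSq_nonneg η (y - b)) h3
      linarith
  have hclosed : IsClosed C := by
    refine isClosed_of_closure_subset fun a ha δ hδ => ?_
    rw [Metric.mem_closure_iff] at ha
    obtain ⟨r, hr, hrδ⟩ : ∃ r > 0, 2 * (r * ‖η‖) ^ 2 < δ / 4 := by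
      have hc : Continuous fun r : ℝ => 2 * (r * ‖η‖) ^ 2 := by fun_prop
      have := (hc.tendsto 0).eventually_lt_const (u := δ / 4) (by simp; positivity)
      obtain ⟨r, h1, h2⟩ := ((this.filter_mono nhdsWithin_le_nhds).and
        (self_mem_nhdsWithin (s := Set.Ioi (0 : ℝ)))).exists
      exact ⟨r, h2, h1⟩
    obtain ⟨b, hb, hab⟩ := ha r hr
    filter_upwards [hb (δ / 4) (by positivity)] with N ⟨x, hx, hxb⟩
    refine ⟨x, hx, ?_⟩
    have h1 : starSq η ((b : H →L[ℂ] H) - a) ≤ 2 * (r * ‖η‖) ^ 2 := by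
      refine (starSq_le η _).trans ?_
      have : ‖(b : H →L[ℂ] H) - a‖ ≤ r := by
        rw [dist_comm, dist_eq_norm] at hab; exact hab.le
      gcongr
    have h2 := starSq_add_le η (x - b) ((b : H →L[ℂ] H) - a)
    rw [sub_add_sub_cancel] at h2
    linarith
  have hmem := CStarAlgebra.mem_closure_convexHull_unitary (A := N₀.1.toStarSubalgebra)
    (x := ⟨a, ha.1⟩) ha.2
  exact closure_minimal (convexHull_min hU hconv) hclosed hmem δ hδ

/-- The nearest-point map to the unit ball depends continuously on the subalgebra. -/
theorem tendsto_starSq_nearest_sub {η : lp (fun _ : ℕ => H) 2} {y : H →L[ℂ] H}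
    {P : M.Subalgebras → H →L[ℂ] H} (hP : ∀ N, P N ∈ N.1.unitBall)
    (hmin : ∀ N, ∀ x ∈ N.1.unitBall, starSq η (P N - y) ≤ starSq η (x - y)) (N₀ : M.Subalgebras) :
    Filter.Tendsto (fun N => starSq η (P N - P N₀)) (@nhds _ M.marechalTopology N₀) (𝓝 0) := by
  let _ := M.marechalTopology
  refine tendsto_order.2 ⟨fun c hc => Filter.Eventually.of_forall fun N =>
    hc.trans_le (starSq_nonneg _ _), fun ε hε => ?_⟩
  set m := starSq η (P N₀ - y) with hm
  have hm0 : 0 ≤ m := starSq_nonneg _ _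
  -- With these `t` and `δ`, `starSq η (x - y) ≤ m + ε / 16`, while `starSq η (P N - y) > m - ε /
  -- 16`; so `P N` and `x` are close.
  set t := ε / 32 / (m + 1) with ht
  have ht0 : 0 < t := by positivity
  have htm : t * m ≤ ε / 32 := by
    rw [ht, div_mul_eq_mul_div, div_le_iff₀ (by positivity)]
    gcongr
    linarith
  set δ := ε / 32 / (1 + t⁻¹) with hδ
  have hδ0 : 0 < δ := by positivity
  have hδt : (1 + t⁻¹) * δ = ε / 32 := by rw [hδ]; field_simp
  have hδε : δ ≤ ε / 32 := by
    have : 0 < t⁻¹ * δ := by positivity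
    linarith
  filter_upwards [eventually_exists_starSq_sub_lt η (hP N₀) hδ0,
    eventually_forall_lt (lowerSemicontinuousOn_starSq_sub η y) (N₀ := N₀) (c := m - ε / 16)
      (fun x hx => by have := hmin N₀ x hx; linarith)] with N ⟨x, hx, hxδ⟩ hN
  have h1 := starSq_sub_nearest_le (hP N) (hmin N) hx
  have h2 := hN _ (hP N)
  have h3 := starSq_add_le_weighted η (P N₀ - y) (x - P N₀) ht0
  have h4 := starSq_add_le η (P N - x) (x - P N₀)
  have h5 : P N₀ - y + (x - P N₀) = x - y := by abel
  rw [sub_add_sub_cancel] at h4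
  rw [h5] at h3
  have h6 : (1 + t⁻¹) * starSq η (x - P N₀) ≤ ε / 32 := by
    rw [← hδt]; gcongr
  linarith

end Marechal

/-! ### From the seminorm to the strong-* topology. -/

section StrongStar

theorem tendsto_strongStarTopology {M : VonNeumannAlgebra H} {η : lp (fun _ : ℕ => H) 2}
    (hη : ∀ ξ : H, ∀ ε > 0, ∃ C : ℝ, 0 ≤ C ∧
      ∀ x ∈ M, ‖x‖ ≤ 2 → ‖x ξ‖ ^ 2 ≤ ε + C * ‖ampl x η‖ ^ 2)
    {ι : Type*} {l : Filter ι} {x : ι → H →L[ℂ] H} {x₀ : H →L[ℂ] H}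
    (hx : ∀ i, x i ∈ M.unitBall) (hx₀ : x₀ ∈ M.unitBall)
    (h : Filter.Tendsto (fun i => starSq η (x i - x₀)) l (𝓝 0)) :
    Filter.Tendsto x l (@nhds _ (strongStarTopology H) x₀) := by
  have key : ∀ z : ι → H →L[ℂ] H, (∀ i, z i ∈ M) → (∀ i, ‖z i‖ ≤ 2) →
      Filter.Tendsto (fun i => starSq η (z i)) l (𝓝 0) →
      ∀ ξ, Filter.Tendsto (fun i => z i ξ) l (𝓝 0) := by
    intro z hz hz2 hlim ξ
    rw [tendsto_zero_iff_norm_tendsto_zero]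
    refine tendsto_order.2 ⟨fun c hc => Filter.Eventually.of_forall fun i =>
      hc.trans_le (norm_nonneg _), fun ε hε => ?_⟩
    obtain ⟨C, hC, hle⟩ := hη ξ (ε ^ 2 / 2) (by positivity)
    have hCl := (hlim.const_mul C).eventually_lt_const (u := ε ^ 2 / 2) (by simp; positivity)
    filter_upwards [hCl] with i hi
    have h1 := hle (z i) (hz i) (hz2 i)
    have h2 : C * ‖ampl (z i) η‖ ^ 2 ≤ C * starSq η (z i) := by
      gcongr
      exact le_add_of_nonneg_right (by positivity)
    exact lt_of_pow_lt_pow_left₀ 2 hε.le (by linarith)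
  have hmem : ∀ i, x i - x₀ ∈ M := fun i => sub_mem (hx i).1 hx₀.1
  have hnorm : ∀ i, ‖x i - x₀‖ ≤ 2 := fun i => by
    linarith [norm_sub_le (x i) x₀, (hx i).2, hx₀.2]
  have h1 := key _ hmem hnorm h
  have h2 := key (fun i => star (x i - x₀)) (fun i => star_mem (hmem i))
    (fun i => by rw [norm_star]; exact hnorm i) (by simpa only [starSq_star] using h)
  rw [nhds_induced, Filter.tendsto_comap_iff]
  refine Filter.Tendsto.prodMk_nhds (tendsto_pi_nhds.2 fun ξ => ?_) (tendsto_pi_nhds.2 fun ξ => ?_)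
  · simpa [tendsto_sub_nhds_zero_iff] using h1 ξ
  · simpa only [star_sub, _root_.sub_apply, tendsto_sub_nhds_zero_iff] using h2 ξ

end StrongStar

end VonNeumannAlgebra

theorem mainTheorem2 {H : Type*} [NormedAddCommGroup H] [InnerProductSpace ℂ H] [CompleteSpace H]
    (M : VonNeumannAlgebra H) (hM : M.HasSeparablePredual) :
    ∃ x : ℕ → M.Subalgebras → M.unitBall,
      (∀ n : ℕ, Continuous[M.marechalTopology,
        (VonNeumannAlgebra.strongStarTopology H).induced Subtype.val] (x n)) ∧
      ∀ N : M.Subalgebras,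
        Set.range (fun n : ℕ => (x n N : H →L[ℂ] H)) ⊆ N.1.unitBall ∧
        N.1.unitBall ⊆ closure[VonNeumannAlgebra.strongStarTopology H]
          (Set.range (fun n : ℕ => (x n N : H →L[ℂ] H))) := by
  obtain ⟨η, hη⟩ := hM.exists_controlling_sequence
  obtain ⟨y, hy⟩ := hM.exists_dense_seq η
  choose P hP hmin using fun (n : ℕ) (N : M.Subalgebras) =>
    VonNeumannAlgebra.exists_nearest η N.1 (y n)
  have hPM : ∀ n N, P n N ∈ M.unitBall := fun n N => ⟨N.2 (hP n N).1, (hP n N).2⟩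
  refine ⟨fun n N => ⟨P n N, hPM n N⟩, fun n => ?_, fun N => ⟨?_, fun a ha => ?_⟩⟩
  · let _ := M.marechalTopology
    let _ := VonNeumannAlgebra.strongStarTopology H
    refine continuous_induced_rng.2 (continuous_iff_continuousAt.2 fun N₀ => ?_)
    exact VonNeumannAlgebra.tendsto_strongStarTopology hη (hPM n) (hPM n N₀)
      (VonNeumannAlgebra.tendsto_starSq_nearest_sub (hP n) (hmin n) N₀)
  · rintro _ ⟨n, rfl⟩
    exact hP n N
  · have haM : a ∈ M.unitBall := ⟨N.2 ha.1, ha.2⟩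
    choose k hk using fun j : ℕ => hy a haM (1 / ((j : ℝ) + 1)) (by positivity)
    let _ := VonNeumannAlgebra.strongStarTopology H
    refine mem_closure_of_tendsto
      (VonNeumannAlgebra.tendsto_strongStarTopology hη (l := Filter.atTop)
        (x := fun j => P (k j) N) (fun j => hPM _ N) haM ?_)
      (Filter.Eventually.of_forall fun j => ⟨k j, rfl⟩)
    -- Since `a` itself competes for nearest point, `starSq η (P (k j) N - a)` is at most `2 *
    -- starSq η (a - y (k j))`.
    refine squeeze_zero (fun j => VonNeumannAlgebra.starSq_nonneg _ _) (fun j => ?_)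
      (by simpa using (tendsto_one_div_add_atTop_nhds_zero_nat (𝕜 := ℝ)).const_mul 2)
    have h1 := VonNeumannAlgebra.starSq_sub_nearest_le (hP (k j) N) (hmin (k j) N) ha
    have h2 := VonNeumannAlgebra.starSq_nonneg η (P (k j) N - y (k j))
    have h3 := hk j
    rw [one_div] at h3
    linarith
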